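/- Let $R$ be a real rational function with $R(0)=1$, $R'(0)=-1$ and $R(s)\in(0,1)$ for all $s>0$, and suppose that the function $$\gamma(s)=\frac{e^{-s}-R(s)}{1-|R(s)|}$$ is bounded on $(0,\infty)$. For $z>0$ let $F_1^{(J)}(z)$ and $F_2^{(J)}(z)$ be the coefficients of the BDF2 fine propagator for Dahlquist's test equation $u'+\lambda u=0$ with fine step $\tau$ and $z=\tau\lambda$: if $\tfrac32U_n-2U_{n-1}+\tfrac12U_{n-2}+zU_n=0$ for all $n\ge1$, then $U_J=F_1^{(J)}(z)U_{-1}+F_2^{(J)}(z)U_0$. For an integer $J\ge 10$ let $G_1=R(Jz)$ and $G_2=R((J-1)z)$ (the coarse propagators of Type (II)), and $$\eta_1=F_1^{(J-1)}-F_1^{(J)}\frac{G_2}{G_1},\qquad \eta_2=F_1^{(J-1)}+F_2^{(J-1)}\frac{G_1}{G_2}-F_1^{(J)}\frac{G_2}{G_1}-F_2^{(J)},$$ $$\eta_3=F_1^{(J)}\frac{G_2}{G_1},\qquad \eta_4=F_1^{(J)}\frac{G_2}{G_1}+F_2^{(J)}-G_1 .$$ Define the functions of $(z,J)$ $$\gamma_a=\sum_{m=0}^\infty|G_1|^m\,\bigl|(m+1)\eta_4^2+\eta_2\eta_3\bigr|,\qquad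 \gamma_b=\frac{|\eta_2\eta_3|}{1-|G_1|}\Bigl(|\eta_1|+\frac{|\eta_4|}{1-|G_1|}\Bigr)^2,$$ $$\gamma_c=\frac{|\eta_2\eta_3^2\eta_4|}{(1-|G_1|)^3}+\frac{|\eta_1\eta_2\eta_3^2|}{(1-|G_1|)^2}+\frac{|\eta_1^2\eta_3\eta_4|}{(1-|G_1|)^2}+\frac{|\eta_1^3\eta_3|}{1-|G_1|},$$ $$\gamma_d=\frac{|G_1\eta_2\eta_4|}{1-|G_1|}+|\eta_2(\eta_4+\eta_1)|,\qquad \gamma_e=\frac{|G_1\eta_2\eta_3|}{1-|G_1|}+|\eta_2\eta_3+\eta_1^2| .$$ Then there is a constant $C$, independent of $z$ and $J$ (it may depend on $R$), such that for all $z>0$ and all integers $J\ge10$ the series $\gamma_a(z,J)$ converges and $$|\gamma_a(z,J)-\gamma(Jz)^2|\le \frac CJ,\qquad \gamma_e(z,J)\le\frac CJ,\qquad \gamma_b(z,J)\le \frac CJ,\qquad \gamma_c(z,J)\,\gamma_d(z,J)\le\frac C{J^2}.$$ Moreover, with the same $C$, each coefficient of the characteristic polynomial $$\xi^3-(\gamma_a+\gamma_e)\xi^2+(\gamma_a\gamma_e-\gamma_b)\xi+(\gamma_b\gamma_e-\gamma_c\gamma_d)$$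 of the error iteration matrix $\begin{pmatrix}\gamma_a&\gamma_b&\gamma_c\\1&0&0\\0&\gamma_d&\gamma_e\end{pmatrix}$ differs from the corresponding coefficient of $\xi^3-\gamma(Jz)^2\xi^2$ by at most $C/J$, and its constant coefficient is at most $C/J^2$ in absolute value. -/

import Mathlib

noncomputable section

namespace Parareal

/-- The numerical solution of the BDF2 scheme with `z = τ λ` for the test equation
`u' + λ u = 0`, shifted by one: `bdf2 z a b n` is the value at the fine time level `n - 1`, with
starting values `a` at level `-1` and `b` at level `0`. -/
def bdf2 (z a b : ℝ) : ℕ → ℝ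
  | 0 => a
  | 1 => b
  | n + 2 => (4 * bdf2 z a b (n + 1) - bdf2 z a b n) / (3 + 2 * z)

/-- The coefficient of the starting value at level `-1` in the fine solution at level `J`. -/
def F₁ (J : ℕ) (z : ℝ) : ℝ := bdf2 z 1 0 (J + 1)

/-- The coefficient of the starting value at level `0` in the fine solution at level `J`. -/
def F₂ (J : ℕ) (z : ℝ) : ℝ := bdf2 z 0 1 (J + 1)

/-- `bdf2` solves the homogeneous BDF2 equation. -/
theorem bdf2_scheme {z : ℝ} (hz : 0 < z) (a b : ℝ) (n : ℕ) :
    3 / 2 * bdf2 z a b (n + 2) - 2 * bdf2 z a b (n + 1) + 1 / 2 * bdf2 z a b n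
      + z * bdf2 z a b (n + 2) = 0 := by
  have h : 3 + 2 * z ≠ 0 := by positivity
  rw [bdf2]
  field_simp
  ring

/-- The fine propagator over `J` fine steps is `(u₋₁, u₀) ↦ F₁ u₋₁ + F₂ u₀`. -/
theorem bdf2_eq (z a b : ℝ) (J : ℕ) : bdf2 z a b (J + 1) = F₁ J z * a + F₂ J z * b := by
  suffices h : ∀ n, bdf2 z a b n = bdf2 z 1 0 n * a + bdf2 z 0 1 n * b from h (J + 1)
  intro n
  induction n using Nat.twoStepInduction with
  | zero => simp [bdf2]
  | one => simp [bdf2]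
  | more n h₁ h₂ =>
    simp only [bdf2, h₁, h₂]
    ring

/-- The value of the rational function `R` at the real number `s`. -/
def val (R : RatFunc ℝ) (s : ℝ) : ℝ := R.eval (RingHom.id ℝ) s

/-- `R(0) = 1`, `R'(0) = -1` and `R(s) ∈ (0,1)` for all `s > 0`. In particular `R` has no pole
in `[0,∞)`, since `val` takes the value `0` at a pole. -/
structure IsStabilityFunction (R : RatFunc ℝ) : Prop where
  val_zero : val R 0 = 1
  deriv_zero : HasDerivAt (val R) (-1) 0
  mem_Ioo : ∀ s : ℝ, 0 < s → val R s ∈ Set.Ioo (0 : ℝ) 1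

/-- The convergence function of the plain parareal algorithm with exact fine propagator. -/
def gamma (R : RatFunc ℝ) (s : ℝ) : ℝ := (Real.exp (-s) - val R s) / (1 - |val R s|)

/-- The symbol `R_i(Jz)` of the `i`-th coarse propagator of Type (II),
where `R_i(s) = R((J - (i - 1)) / J * s)`. -/
def G (R : RatFunc ℝ) (i : ℕ) (z : ℝ) (J : ℕ) : ℝ :=
  val R (((J : ℝ) - ((i : ℝ) - 1)) / (J : ℝ) * ((J : ℝ) * z))

def eta₁ (R : RatFunc ℝ) (z : ℝ) (J : ℕ) : ℝ :=
  F₁ (J - 1) z - F₁ J z * G R 2 z J * (G R 1 z J)⁻¹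

def eta₂ (R : RatFunc ℝ) (z : ℝ) (J : ℕ) : ℝ :=
  F₁ (J - 1) z + F₂ (J - 1) z * G R 1 z J * (G R 2 z J)⁻¹
    - F₁ J z * G R 2 z J * (G R 1 z J)⁻¹ - F₂ J z

def eta₃ (R : RatFunc ℝ) (z : ℝ) (J : ℕ) : ℝ :=
  F₁ J z * G R 2 z J * (G R 1 z J)⁻¹

def eta₄ (R : RatFunc ℝ) (z : ℝ) (J : ℕ) : ℝ :=
  F₁ J z * G R 2 z J * (G R 1 z J)⁻¹ + F₂ J z - G R 1 z J

/-- The `m`-th term of the series that defines `gammaA`. -/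
def gammaATerm (R : RatFunc ℝ) (z : ℝ) (J : ℕ) (m : ℕ) : ℝ :=
  |G R 1 z J| ^ m * |((m : ℝ) + 1) * eta₄ R z J ^ 2 + eta₂ R z J * eta₃ R z J|

def gammaA (R : RatFunc ℝ) (z : ℝ) (J : ℕ) : ℝ := ∑' m : ℕ, gammaATerm R z J m

def gammaB (R : RatFunc ℝ) (z : ℝ) (J : ℕ) : ℝ :=
  |eta₂ R z J * eta₃ R z J| / (1 - |G R 1 z J|)
    * (|eta₁ R z J| + |eta₄ R z J| / (1 - |G R 1 z J|)) ^ 2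

def gammaC (R : RatFunc ℝ) (z : ℝ) (J : ℕ) : ℝ :=
  |eta₂ R z J * eta₃ R z J ^ 2 * eta₄ R z J| / (1 - |G R 1 z J|) ^ 3
    + |eta₁ R z J * eta₂ R z J * eta₃ R z J ^ 2| / (1 - |G R 1 z J|) ^ 2
    + |eta₁ R z J ^ 2 * eta₃ R z J * eta₄ R z J| / (1 - |G R 1 z J|) ^ 2
    + |eta₁ R z J ^ 3 * eta₃ R z J| / (1 - |G R 1 z J|)

def gammaD (R : RatFunc ℝ) (z : ℝ) (J : ℕ) : ℝ :=
  |G R 1 z J * eta₂ R z J * eta₄ R z J| / (1 - |G R 1 z J|)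
    + |eta₂ R z J * (eta₄ R z J + eta₁ R z J)|

def gammaE (R : RatFunc ℝ) (z : ℝ) (J : ℕ) : ℝ :=
  |G R 1 z J * eta₂ R z J * eta₃ R z J| / (1 - |G R 1 z J|)
    + |eta₂ R z J * eta₃ R z J + eta₁ R z J ^ 2|

/-- The iteration matrix of the error recursion. -/
def errorMatrix (R : RatFunc ℝ) (z : ℝ) (J : ℕ) : Matrix (Fin 3) (Fin 3) ℝ :=
  !![gammaA R z J, gammaB R z J, gammaC R z J;
     1, 0, 0;
     0, gammaD R z J, gammaE R z J]

end Parareal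

end

open Parareal

/-! Write `m = min 1 (J * z)`. In the `gamma` quantities the `eta`s are divided by powers of `1 -
G₁`, which degenerates as `J * z → 0`. A bare `O(1/J)` bound on `eta₂`, or on the error in `eta₄`,
would not survive that division; the bound needed is `O(m / J)`. Boundedness of `gamma` supplies the
matching lower bound `m ≤ const * (1 - G₁)` (`IsStabilityFunction.min_le`).

The `O(m / J)` bounds have two sources. On the fine side, BDF2 solutions decay exponentially by
G-stability (`abs_bdf2_le`). For small `z` the solution started from `1, 1` moves by `O(z)` per step
(`abs_bdf2_sub_le`) and follows `exp (-J z)` by consistency (`abs_bdf2_sub_exp_le`). For large `z`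
everything is exponentially small in `J`. On the coarse side, `log R` has derivative `O(1 / (1 +
s))` because `R` is rational without zeros or poles on `[0,∞)`, so `G₁ / G₂` and `G₂ / G₁` are `1 +
O(m / J)`.

Hence `eta₁ = O(1/J)`, `eta₂ / (1 - G₁) = O(1/J)` and `eta₄ / (1 - G₁) = gamma + O(1/J)`, collected
in `EtaBound`. The series `gammaA` is a perturbation of `∑ (m + 1) G₁ᵐ eta₄² = (eta₄ / (1 - G₁))²`,
and the other entries are products of these bounds. -/

namespace Parareal

/-! ### Stability of BDF2 by an energy argument. -/

/-- The discrete energy of two consecutive values `u, v` of the BDF2 scheme. -/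
def energy (z u v : ℝ) : ℝ := (1 + 2 * z) * v ^ 2 + (2 * v - u) ^ 2

/-- G-stability of BDF2: multiplying the scheme by `4 w` gives `w² + (2w - v)² - v² - (2v - u)² + (w
- 2v + u)² + 4 z w² = 0`. Half of `4 z w²` goes into the energy and half stays as dissipation. No
factor `z` remains on the right, so the first step absorbs arbitrary starting values uniformly in
`z`. -/
theorem energy_add_le {z : ℝ} (hz : 0 < z) (a b : ℝ) (n : ℕ) :
    energy z (bdf2 z a b (n + 1)) (bdf2 z a b (n + 2)) + 2 * z * bdf2 z a b (n + 2) ^ 2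
      ≤ bdf2 z a b (n + 1) ^ 2 + (2 * bdf2 z a b (n + 1) - bdf2 z a b n) ^ 2 := by
  have h := bdf2_scheme hz a b n
  generalize bdf2 z a b (n + 2) = w at *
  generalize bdf2 z a b (n + 1) = v at *
  generalize bdf2 z a b n = u at *
  have h2 : 4 * w * (3 / 2 * w - 2 * v + 1 / 2 * u + z * w) = 0 := by rw [h, mul_zero]
  unfold energy
  nlinarith [sq_nonneg (w - 2 * v + u)]

/-- The two halves of the dissipation add up to `2 z (v² + w²)`, which controls a fixed fraction of
the energy because `energy z v w ≤ (9 + 2z)(v² + w²)`. -/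
theorem energy_contract {z : ℝ} (hz : 0 < z) (a b : ℝ) (n : ℕ) :
    (9 + 4 * z) * energy z (bdf2 z a b (n + 1)) (bdf2 z a b (n + 2))
      ≤ (9 + 2 * z) * energy z (bdf2 z a b n) (bdf2 z a b (n + 1)) := by
  have h := energy_add_le hz a b n
  generalize bdf2 z a b (n + 2) = w at *
  generalize bdf2 z a b (n + 1) = v at *
  generalize bdf2 z a b n = u at *
  have h1 : energy z v w + 2 * z * (v ^ 2 + w ^ 2) ≤ energy z u v := by
    simp only [energy] at h ⊢; linarith
  have h2 : energy z v w ≤ (9 + 2 * z) * (v ^ 2 + w ^ 2) := by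
    simp only [energy]; nlinarith [sq_nonneg (2 * v + w), mul_nonneg hz.le (sq_nonneg v),
      sq_nonneg v, sq_nonneg w]
  have h3 := mul_le_mul_of_nonneg_left h1 (by linarith : (0 : ℝ) ≤ 9 + 2 * z)
  have h4 := mul_le_mul_of_nonneg_left h2 (by linarith : (0 : ℝ) ≤ 2 * z)
  nlinarith

/-- The rate `c` is left free so that one estimate serves `c = z` for small `z`, `c = 1/4` for large
`z`, and `c = 0` for plain boundedness. The factor `1/5` comes from `(9 + 4z) c ≤ 9z + z = 10z`. -/
theorem energy_contract_exp {z c : ℝ} (hz : 0 < z) (hcz : c ≤ z) (hc4 : c ≤ 1 / 4)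
    (a b : ℝ) (n : ℕ) :
    energy z (bdf2 z a b (n + 1)) (bdf2 z a b (n + 2))
      ≤ Real.exp (-(c / 5)) * energy z (bdf2 z a b n) (bdf2 z a b (n + 1)) := by
  have h := energy_contract hz a b n
  have hE : 0 ≤ energy z (bdf2 z a b n) (bdf2 z a b (n + 1)) := by unfold energy; positivity
  have h1 : 1 - c / 5 ≤ Real.exp (-(c / 5)) := by
    have := Real.add_one_le_exp (-(c / 5)); linarith
  have h2 : 9 + 2 * z ≤ (9 + 4 * z) * (1 - c / 5) := by nlinarith
  have h3 : 9 + 2 * z ≤ (9 + 4 * z) * Real.exp (-(c / 5)) :=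
    h2.trans (mul_le_mul_of_nonneg_left h1 (by positivity))
  have h4 := h.trans (mul_le_mul_of_nonneg_right h3 hE)
  rw [mul_assoc] at h4
  exact le_of_mul_le_mul_left h4 (by positivity)

/-- Every solution of the BDF2 scheme decays exponentially, uniformly in `z`. -/
theorem abs_bdf2_le {z c : ℝ} (hz : 0 < z) (hc : 0 ≤ c) (hcz : c ≤ z) (hc4 : c ≤ 1 / 4)
    {a b : ℝ} (ha : |a| ≤ 1) (hb : |b| ≤ 1) (n : ℕ) :
    |bdf2 z a b n| ≤ 4 * Real.exp (-(c * n / 10)) := by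
  -- The induction starts at levels `1, 2`, since the energy of the starting values themselves grows
  -- with `z`. Here `10 = 1 + 9` bounds `b² + (2b - a)²`.
  have hE : ∀ n : ℕ, energy z (bdf2 z a b (n + 1)) (bdf2 z a b (n + 2))
      ≤ 10 * Real.exp (-(c * n / 5)) := by
    intro n
    induction n with
    | zero =>
      have h := energy_add_le hz a b 0
      have h0 : bdf2 z a b 0 = a := by rw [bdf2]
      have h1 : bdf2 z a b 1 = b := by rw [bdf2]
      simp only [zero_add, h0, h1] at h ⊢
      have : 0 ≤ 2 * z * bdf2 z a b 2 ^ 2 := by positivity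
      rw [abs_le] at ha hb
      have hb2 : b ^ 2 ≤ 1 := by nlinarith
      have ha2 : (2 * b - a) ^ 2 ≤ 9 := by nlinarith
      simp only [Nat.cast_zero, mul_zero, zero_div, neg_zero, Real.exp_zero]
      linarith
    | succ n ih =>
      refine (energy_contract_exp hz hcz hc4 a b (n + 1)).trans ?_
      refine (mul_le_mul_of_nonneg_left ih (Real.exp_pos _).le).trans (le_of_eq ?_)
      rw [mul_left_comm, ← Real.exp_add]
      push_cast
      ring_nf
  have hsmall : ∀ x : ℝ, x ≤ 1 / 2 → 1 ≤ 2 * Real.exp (-x) := by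
    intro x hx
    have := Real.add_one_le_exp (-x); linarith
  match n with
  | 0 =>
    rw [bdf2]; simp only [Nat.cast_zero, mul_zero, zero_div, neg_zero, Real.exp_zero]; linarith
  | 1 =>
    rw [bdf2]
    have := hsmall (c * (1 : ℕ) / 10) (by push_cast; linarith)
    linarith
  | n + 2 =>
    apply abs_le_of_sq_le_sq _ (by positivity)
    have h1 : bdf2 z a b (n + 2) ^ 2
        ≤ energy z (bdf2 z a b (n + 1)) (bdf2 z a b (n + 2)) := by
      unfold energy
      nlinarith [mul_nonneg hz.le (sq_nonneg (bdf2 z a b (n + 2))),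
        sq_nonneg (2 * bdf2 z a b (n + 2) - bdf2 z a b (n + 1))]
    have h2 := h1.trans (hE n)
    have h3 : Real.exp (-(c * n / 5))
        = Real.exp (-(c * (n + 2 : ℕ) / 10)) ^ 2 * Real.exp (2 * c / 5) := by
      rw [← Real.exp_nat_mul, ← Real.exp_add]; push_cast; ring_nf
    -- The index shift by two costs at most `8/5`, and `10 * 8/5 = 4²`.
    have h4 : Real.exp (2 * c / 5) ≤ 8 / 5 := by
      have h5 : Real.exp (2 * c / 5) ≤ 1 / (1 - 2 * c / 5) :=
        Real.exp_bound_div_one_sub_of_interval (by positivity) (by linarith)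
      refine h5.trans ?_
      rw [div_le_div_iff₀ (by linarith) (by norm_num)]
      linarith
    rw [h3] at h2
    nlinarith [sq_nonneg (Real.exp (-(c * (n + 2 : ℕ) / 10)))]

/-- The increments of a BDF2 solution for small `z`. -/
theorem abs_bdf2_sub_le {z : ℝ} (hz : 0 < z) (hz4 : z ≤ 1 / 4)
    {a b : ℝ} (ha : |a| ≤ 1) (hb : |b| ≤ 1) (n : ℕ) :
    |bdf2 z a b (n + 1) - bdf2 z a b n|
      ≤ |b - a| * (1 / 3) ^ n + 8 * z * Real.exp (-(z * n / 10)) := by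
  induction n with
  | zero =>
    simp only [bdf2, pow_zero, mul_one]
    have : 0 ≤ 8 * z * Real.exp (-(z * (0 : ℕ) / 10)) := by positivity
    linarith
  | succ n ih =>
    have hs := bdf2_scheme hz a b n
    have hw := abs_bdf2_le hz hz.le le_rfl hz4 ha hb (n + 2)
    -- Increments obey a recursion with the parasitic root `1/3`, forced by a term of size `z`. The
    -- constant `8` reproduces itself: `8 * 2/3 + 4 * 2/3 = 8`.
    have hd : bdf2 z a b (n + 2) - bdf2 z a b (n + 1)
        = 1 / 3 * (bdf2 z a b (n + 1) - bdf2 z a b n) - 2 / 3 * z * bdf2 z a b (n + 2) := by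
      linarith
    have h1 : |bdf2 z a b (n + 2) - bdf2 z a b (n + 1)|
        ≤ 1 / 3 * |bdf2 z a b (n + 1) - bdf2 z a b n| + 2 / 3 * z * |bdf2 z a b (n + 2)| := by
      conv_lhs => rw [hd]
      refine (abs_sub _ _).trans (le_of_eq ?_)
      rw [abs_mul, abs_mul, abs_of_pos (by positivity : 0 < 2 / 3 * z),
        abs_of_pos (by norm_num : (0 : ℝ) < 1 / 3)]
    have h2 : Real.exp (-(z * (n + 2 : ℕ) / 10)) ≤ Real.exp (-(z * (n + 1 : ℕ) / 10)) := by
      apply Real.exp_le_exp.2; push_cast; linarith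
    have h3 : Real.exp (-(z * n / 10)) ≤ 2 * Real.exp (-(z * (n + 1 : ℕ) / 10)) := by
      have h4 : Real.exp (-(z * (n + 1 : ℕ) / 10))
          = Real.exp (-(z * n / 10)) * Real.exp (-(z / 10)) := by
        rw [← Real.exp_add]; push_cast; ring_nf
      have h5 := Real.add_one_le_exp (-(z / 10))
      rw [h4]
      nlinarith [Real.exp_pos (-(z * n / 10))]
    have h6 : 2 / 3 * z * |bdf2 z a b (n + 2)|
        ≤ 2 / 3 * z * (4 * Real.exp (-(z * (n + 1 : ℕ) / 10))) :=
      mul_le_mul_of_nonneg_left (by linarith) (by positivity)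
    have h7 := mul_le_mul_of_nonneg_left h3 (by positivity : 0 ≤ 8 * z)
    rw [pow_succ]
    show |bdf2 z a b (n + 2) - bdf2 z a b (n + 1)| ≤ _
    linarith

/-! ### Consistency of BDF2 with the exponential. -/

/-- Variation of constants for the BDF2 scheme with a right-hand side. -/
theorem eq_bdf2_add_sum (z : ℝ) (x g : ℕ → ℝ)
    (hx : ∀ n, x (n + 2) = (4 * x (n + 1) - x n) / (3 + 2 * z) + g n) (n : ℕ) :
    x (n + 1) = bdf2 z (x 0) (x 1) (n + 1)
      + ∑ k ∈ Finset.range n, g k * bdf2 z 0 1 (n - k) := by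
  induction n using Nat.twoStepInduction with
  | zero => simp [bdf2]
  | one => simp [bdf2, hx 0]
  | more n h₁ h₂ =>
    have hs : ∑ k ∈ Finset.range n, g k * bdf2 z 0 1 (n + 2 - k)
        = (4 * ∑ k ∈ Finset.range n, g k * bdf2 z 0 1 (n + 1 - k)
          - ∑ k ∈ Finset.range n, g k * bdf2 z 0 1 (n - k)) / (3 + 2 * z) := by
      rw [Finset.mul_sum, ← Finset.sum_sub_distrib, Finset.sum_div]
      refine Finset.sum_congr rfl fun k hk => ?_
      have hk : k < n := Finset.mem_range.1 hk
      obtain ⟨j, rfl⟩ := Nat.exists_eq_add_of_lt hk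
      have e1 : k + j + 1 + 2 - k = (j + 1) + 2 := by omega
      have e2 : k + j + 1 + 1 - k = (j + 1) + 1 := by omega
      have e3 : k + j + 1 - k = j + 1 := by omega
      rw [e1, e2, e3, bdf2]
      ring
    rw [Finset.sum_range_succ] at h₂
    rw [hx (n + 1), h₁, h₂, Finset.sum_range_succ, Finset.sum_range_succ, hs, bdf2.eq_3 z (x 0)]
    have e1 : n + 2 - n = 2 := by omega
    have e2 : n + 2 - (n + 1) = 1 := by omega
    have e3 : n + 1 - n = 1 := by omega
    rw [e1, e2, e3]
    simp only [bdf2]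
    ring

/-- The Taylor terms up to order two cancel: BDF2 has second order, hence a local defect of third
order. -/
theorem abs_bdf2_residual_le {z : ℝ} (hz : 0 < z) (hz4 : z ≤ 1 / 4) :
    |3 + 2 * z - 4 * Real.exp z + Real.exp (2 * z)| ≤ 12 * z ^ 3 := by
  have h1 := Real.exp_bound (x := z) (by rw [abs_of_pos hz]; linarith) (n := 3) (by norm_num)
  have h2 := Real.exp_bound (x := 2 * z) (by rw [abs_of_pos (by positivity)]; linarith) (n := 3)
    (by norm_num)
  simp only [Finset.sum_range_succ, Finset.sum_range_zero, Nat.factorial, abs_of_pos hz,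
    abs_of_pos (by positivity : 0 < 2 * z)] at h1 h2
  norm_num at h1 h2
  rw [abs_le] at *
  have : 0 < z ^ 3 := by positivity
  constructor <;> nlinarith

/-- For small `z` the BDF2 solution started with `1, 1` is close to the exponential. -/
theorem abs_bdf2_sub_exp_le {z : ℝ} (hz : 0 < z) (hz4 : z ≤ 1 / 4) (J : ℕ) :
    |bdf2 z 1 1 (J + 1) - Real.exp (-(J * z))|
      ≤ (8 * z + 16 * J * z ^ 3) * Real.exp (-(J * z / 10)) := by
  set r := 3 + 2 * z - 4 * Real.exp z + Real.exp (2 * z) with hr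
  have hr12 : |r| ≤ 12 * z ^ 3 := abs_bdf2_residual_le hz hz4
  have hD : 0 < 3 + 2 * z := by positivity
  set g : ℕ → ℝ := fun n => Real.exp (-((n + 1) * z)) * (r / (3 + 2 * z)) with hg
  -- The exact solution is sampled with index `0` at level `-1`, so its starting values are `exp z`
  -- and `1`. The error then consists of a starting error `O(z)` and `J` defects `O(z³)`.
  have hx := eq_bdf2_add_sum z (fun n => Real.exp (z - n * z)) g (by
    intro n
    simp only [hg]
    have e1 : Real.exp (z - (n + 1 : ℕ) * z) = Real.exp (-((n + 1) * z)) * Real.exp z := by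
      rw [← Real.exp_add]; push_cast; ring_nf
    have e2 : Real.exp (z - n * z) = Real.exp (-((n + 1) * z)) * Real.exp (2 * z) := by
      rw [← Real.exp_add]; ring_nf
    have e3 : Real.exp (z - (n + 2 : ℕ) * z) = Real.exp (-((n + 1) * z)) := by
      push_cast; ring_nf
    rw [e1, e2, e3, hr]
    field_simp
    ring) J
  simp only [Nat.cast_zero, Nat.cast_one, zero_mul, one_mul, sub_zero, sub_self,
    Real.exp_zero] at hx
  have e0 : Real.exp (z - (J + 1 : ℕ) * z) = Real.exp (-(J * z)) := by push_cast; ring_nf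
  rw [e0, bdf2_eq] at hx
  rw [hx, bdf2_eq]
  have hF : |F₁ J z| ≤ 4 * Real.exp (-(J * z / 10)) := by
    refine (abs_bdf2_le hz hz.le le_rfl hz4 (by norm_num) (by norm_num) (J + 1)).trans ?_
    refine mul_le_mul_of_nonneg_left (Real.exp_le_exp.2 ?_) (by norm_num)
    push_cast; linarith
  have he : |1 - Real.exp z| ≤ 2 * z := by
    have h1 := Real.add_one_le_exp z
    have h5 : Real.exp z ≤ 1 / (1 - z) :=
      Real.exp_bound_div_one_sub_of_interval hz.le (by linarith)
    have h6 : 1 / (1 - z) ≤ 1 + 2 * z := by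
      rw [div_le_iff₀ (by linarith)]; nlinarith
    rw [abs_le]; constructor <;> linarith
  have hgk : ∀ k ∈ Finset.range J, |g k * bdf2 z 0 1 (J - k)|
      ≤ 16 * z ^ 3 * Real.exp (-(J * z / 10)) := by
    intro k hk
    have hk : k < J := Finset.mem_range.1 hk
    have h1 := abs_bdf2_le hz hz.le le_rfl hz4 (a := 0) (b := 1) (by norm_num) (by norm_num)
      (J - k)
    have h2 : |g k| ≤ Real.exp (-((k + 1) * z)) * (4 * z ^ 3) := by
      simp only [hg]
      rw [abs_mul, abs_of_pos (Real.exp_pos _), abs_div, abs_of_pos hD]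
      refine mul_le_mul_of_nonneg_left ?_ (Real.exp_pos _).le
      rw [div_le_iff₀ hD]
      nlinarith [pow_pos hz 3, pow_pos hz 4]
    rw [abs_mul]
    refine (mul_le_mul h2 h1 (abs_nonneg _) (by positivity)).trans ?_
    have h3 : Real.exp (-((k + 1) * z)) * Real.exp (-(z * (J - k : ℕ) / 10))
        ≤ Real.exp (-(J * z / 10)) := by
      rw [← Real.exp_add]
      apply Real.exp_le_exp.2
      rw [Nat.cast_sub hk.le]
      have : 0 ≤ (k : ℝ) * z := by positivity
      nlinarith
    have : 0 < z ^ 3 := by positivity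
    nlinarith
  have hsum : |∑ k ∈ Finset.range J, g k * bdf2 z 0 1 (J - k)|
      ≤ J * (16 * z ^ 3 * Real.exp (-(J * z / 10))) := by
    refine (Finset.abs_sum_le_sum_abs _ _).trans ((Finset.sum_le_sum hgk).trans ?_)
    simp
  have hm : |F₁ J z * (1 - Real.exp z)| ≤ 4 * Real.exp (-(J * z / 10)) * (2 * z) := by
    rw [abs_mul]
    exact mul_le_mul hF he (abs_nonneg _) (by positivity)
  calc _ = |F₁ J z * (1 - Real.exp z) - ∑ k ∈ Finset.range J, g k * bdf2 z 0 1 (J - k)| := by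
        congr 1; ring
    _ ≤ _ := abs_sub _ _
    _ ≤ _ := by linarith

/-! ### Bounds on the fine propagator, uniform in `z` and `J`. -/

theorem pow_mul_exp_neg_le {s : ℝ} (hs : 0 ≤ s) (n : ℕ) :
    s ^ n * Real.exp (-(s / 10)) ≤ n.factorial * 10 ^ n := by
  have h := Real.pow_div_factorial_le_exp (s / 10) (by positivity) n
  rw [div_pow, div_div, div_le_iff₀ (by positivity)] at h
  rw [Real.exp_neg, ← div_eq_mul_inv, div_le_iff₀ (Real.exp_pos _)]
  linarith

/-- Converts powers of `s = J * z` damped by the exponential into the factor `min 1 s`, to be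
absorbed later by `1 - R s`. -/
theorem pow_succ_mul_exp_neg_le {s : ℝ} (hs : 0 ≤ s) (n : ℕ) :
    s ^ (n + 1) * Real.exp (-(s / 10)) ≤ (n + 1).factorial * 10 ^ (n + 1) * min 1 s := by
  rcases min_cases 1 s with ⟨h, _⟩ | ⟨h, _⟩ <;> rw [h]
  · rw [mul_one]; exact pow_mul_exp_neg_le hs (n + 1)
  · have h1 := mul_le_mul_of_nonneg_right (pow_mul_exp_neg_le hs n) hs
    have h2 : (n.factorial * 10 ^ n : ℝ) ≤ (n + 1).factorial * 10 ^ (n + 1) := by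
      gcongr
      · exact n.le_succ
      · norm_num
      · exact n.le_succ
    calc _ = s ^ n * Real.exp (-(s / 10)) * s := by ring
      _ ≤ _ := h1
      _ ≤ _ := mul_le_mul_of_nonneg_right h2 hs

theorem exp_neg_div_forty_le {J : ℕ} (hJ : 0 < J) : Real.exp (-((J : ℝ) / 40)) ≤ 40 / J := by
  have hJ' : (0 : ℝ) < J := by exact_mod_cast hJ
  have h := Real.add_one_le_exp ((J : ℝ) / 40)
  rw [Real.exp_neg, inv_le_comm₀ (Real.exp_pos _) (by positivity), inv_div]
  linarith

theorem abs_bdf2_le_four {z : ℝ} (hz : 0 < z) {a b : ℝ} (ha : |a| ≤ 1) (hb : |b| ≤ 1) (n : ℕ) :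
    |bdf2 z a b n| ≤ 4 := by
  simpa using abs_bdf2_le hz le_rfl hz.le (by norm_num) ha hb n

theorem abs_F₁_le {z : ℝ} (hz : 0 < z) (J : ℕ) : |F₁ J z| ≤ 4 :=
  abs_bdf2_le_four hz (by norm_num) (by norm_num) _

theorem abs_F₂_le {z : ℝ} (hz : 0 < z) (J : ℕ) : |F₂ J z| ≤ 4 :=
  abs_bdf2_le_four hz (by norm_num) (by norm_num) _

theorem abs_bdf2_le_div {z : ℝ} (hz : 1 / 4 ≤ z) {a b : ℝ} (ha : |a| ≤ 1) (hb : |b| ≤ 1)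
    {J n : ℕ} (hJ : 0 < J) (hn : J ≤ n) : |bdf2 z a b n| ≤ 160 / J := by
  have h := abs_bdf2_le (by linarith) (by norm_num) hz le_rfl ha hb n
  have h1 := exp_neg_div_forty_le hJ
  have h2 : Real.exp (-(1 / 4 * n / 10)) ≤ Real.exp (-((J : ℝ) / 40)) := by
    apply Real.exp_le_exp.2
    have : (J : ℝ) ≤ n := by exact_mod_cast hn
    linarith
  calc _ ≤ _ := h
    _ ≤ 4 * (40 / J) := by linarith
    _ = _ := by ring

theorem abs_bdf2_sub_le_of_large {z : ℝ} (hz : 1 / 4 ≤ z) {a b : ℝ} (ha : |a| ≤ 1)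
    (hb : |b| ≤ 1) {J : ℕ} (hJ : 0 < J) :
    |bdf2 z a b (J + 1) - bdf2 z a b J| ≤ 320 / J := by
  refine (abs_sub _ _).trans ?_
  have h1 := abs_bdf2_le_div hz ha hb hJ le_rfl
  have h2 := abs_bdf2_le_div hz ha hb hJ J.le_succ
  calc _ ≤ (160 / J + 160 / J : ℝ) := add_le_add h2 h1
    _ = _ := by ring

theorem mul_exp_neg_le_min {z : ℝ} (hz : 0 < z) {J : ℕ} (hJ : 0 < J) :
    8 * z * Real.exp (-(z * J / 10)) ≤ 80 * min 1 (J * z) / J := by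
  have hJ' : (0 : ℝ) < J := by exact_mod_cast hJ
  have h := pow_succ_mul_exp_neg_le (s := J * z) (by positivity) 0
  norm_num at h
  rw [le_div_iff₀ hJ', mul_comm z J]
  linarith

theorem min_eq_one {z : ℝ} (hz : 1 / 4 ≤ z) {J : ℕ} (hJ : 10 ≤ J) : min 1 (J * z) = 1 := by
  have hJ' : (10 : ℝ) ≤ J := by exact_mod_cast hJ
  exact min_eq_left (by nlinarith)

/-- Starting values `1, 0` excite the parasitic mode `(1/3)^J`, which does not vanish as `z → 0`;
hence no factor `min 1 (J * z)` here. -/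
theorem abs_F₁_sub_le {z : ℝ} (hz : 0 < z) {J : ℕ} (hJ : 10 ≤ J) :
    |F₁ (J - 1) z - F₁ J z| ≤ 320 / J := by
  have hJ0 : 0 < J := by omega
  have hJ' : (0 : ℝ) < J := by exact_mod_cast hJ0
  rw [abs_sub_comm, F₁, F₁, Nat.sub_add_cancel hJ0]
  rcases le_total z (1 / 4) with h | h
  · refine (abs_bdf2_sub_le hz h (by norm_num) (by norm_num) J).trans ?_
    have h1 := mul_exp_neg_le_min hz hJ0
    have h2 : 80 * min 1 (J * z) / J ≤ 80 / J := by
      gcongr; linarith [min_le_left 1 (J * z)]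
    have h3 : (1 / 3 : ℝ) ^ J ≤ 1 / J := by
      rw [div_pow, one_pow]
      apply one_div_le_one_div_of_le hJ'
      exact_mod_cast (Nat.lt_pow_self (by norm_num : 1 < 3)).le
    have h4 : (1 / J + 80 / J : ℝ) ≤ 320 / J := by
      rw [← add_div]; gcongr; norm_num
    norm_num at h3 ⊢
    norm_num at h1 h4
    linarith
  · exact abs_bdf2_sub_le_of_large h (by norm_num) (by norm_num) hJ0

theorem F₁_add_F₂ (z : ℝ) (J : ℕ) : F₁ J z + F₂ J z = bdf2 z 1 1 (J + 1) := by
  rw [bdf2_eq]; ring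

/-- With equal starting values the parasitic term has coefficient zero, and the gain `min 1 (J * z)`
appears. -/
theorem abs_F₁_add_F₂_sub_le {z : ℝ} (hz : 0 < z) {J : ℕ} (hJ : 10 ≤ J) :
    |(F₁ (J - 1) z + F₂ (J - 1) z) - (F₁ J z + F₂ J z)| ≤ 320 * min 1 (J * z) / J := by
  have hJ0 : 0 < J := by omega
  rw [abs_sub_comm, F₁_add_F₂, F₁_add_F₂, Nat.sub_add_cancel hJ0]
  rcases le_total z (1 / 4) with h | h
  · refine (abs_bdf2_sub_le hz h (by norm_num) (by norm_num) J).trans ?_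
    have h1 := mul_exp_neg_le_min hz hJ0
    have h2 : 80 * min 1 (J * z) / J ≤ 320 * min 1 (J * z) / J := by gcongr; norm_num
    simp only [sub_self, abs_zero, zero_mul, zero_add]
    linarith
  · rw [min_eq_one h hJ, mul_one]
    exact abs_bdf2_sub_le_of_large h (by norm_num) (by norm_num) hJ0

theorem abs_F₁_add_F₂_sub_exp_le {z : ℝ} (hz : 0 < z) {J : ℕ} (hJ : 10 ≤ J) :
    |F₁ J z + F₂ J z - Real.exp (-(J * z))| ≤ 100000 * min 1 (J * z) / J := by
  have hJ0 : 0 < J := by omega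
  have hJ' : (0 : ℝ) < J := by exact_mod_cast hJ0
  have hJ1 : (1 : ℝ) ≤ J := by exact_mod_cast hJ0
  rw [F₁_add_F₂]
  rcases le_total z (1 / 4) with h | h
  · refine (abs_bdf2_sub_exp_le hz h J).trans ?_
    have h1 := pow_succ_mul_exp_neg_le (s := J * z) (by positivity) 0
    have h3 := pow_succ_mul_exp_neg_le (s := J * z) (by positivity) 2
    norm_num [Nat.factorial] at h1 h3
    have hm : 0 ≤ min 1 (J * z) := by positivity
    rw [le_div_iff₀ hJ']
    have h4 : 16 * J * z ^ 3 * Real.exp (-(J * z / 10)) * J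
        ≤ 16 * ((J * z) ^ 3 * Real.exp (-(J * z / 10))) := by
      have : 16 * ((J * z) ^ 3 * Real.exp (-(J * z / 10)))
        = 16 * J * z ^ 3 * Real.exp (-(J * z / 10)) * J * J := by ring
      rw [this]
      exact le_mul_of_one_le_right (by positivity) hJ1
    nlinarith
  · rw [min_eq_one h hJ, mul_one]
    have h1 := abs_bdf2_le_div h (a := 1) (b := 1) (by norm_num) (by norm_num) hJ0 J.le_succ
    have h2 : Real.exp (-(J * z)) ≤ 40 / J := by
      refine le_trans (Real.exp_le_exp.2 ?_) (exp_neg_div_forty_le hJ0)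
      nlinarith
    refine (abs_sub _ _).trans ?_
    rw [abs_of_pos (Real.exp_pos _)]
    calc _ ≤ (160 / J + 40 / J : ℝ) := add_le_add h1 h2
      _ = 200 / J := by ring
      _ ≤ _ := by gcongr; norm_num

/-! ### The coarse propagator -/

/-- A polynomial without zeros in `[0,∞)` has a logarithmic derivative of order `1 / (1 + s)`. -/
theorem exists_abs_derivative_le (p : Polynomial ℝ) (hp : ∀ s : ℝ, 0 ≤ s → p.eval s ≠ 0) :
    ∃ C : ℝ, 0 ≤ C ∧ ∀ s : ℝ, 0 ≤ s → |p.derivative.eval s / p.eval s| ≤ C / (1 + s) := by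
  -- The weight `1 + X` compensates the degree lost by differentiation, so `q / p` is bounded at
  -- infinity; compactness covers the rest of the half-line.
  set q : Polynomial ℝ := (1 + Polynomial.X) * p.derivative with hq
  have hdeg : q.degree ≤ p.degree := by
    rcases eq_or_ne p.derivative 0 with h0 | h0
    · simp [hq, h0]
    have h1 : (1 + Polynomial.X : Polynomial ℝ).degree = 1 := by
      rw [add_comm]; exact Polynomial.degree_X_add_C 1
    have hp0 : p ≠ 0 := by rintro rfl; simp at h0
    have h2 := Polynomial.degree_derivative_lt hp0
    rw [hq, Polynomial.degree_mul, h1, add_comm]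
    rw [Polynomial.degree_eq_natDegree h0, Polynomial.degree_eq_natDegree hp0] at h2 ⊢
    have h3 : p.derivative.natDegree < p.natDegree := by exact_mod_cast h2
    exact_mod_cast h3
  obtain ⟨c, hc⟩ := (Polynomial.isBigO_atTop_of_degree_le q p hdeg).bound
  obtain ⟨N, hN⟩ := Filter.eventually_atTop.1 hc
  have hcont : ContinuousOn (fun s => q.eval s / p.eval s) (Set.Icc 0 N) :=
    q.continuous.continuousOn.div p.continuous.continuousOn fun s hs => hp s hs.1
  obtain ⟨d, hd⟩ := isCompact_Icc.exists_bound_of_continuousOn hcont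
  refine ⟨max 0 (max c d), le_max_left _ _, fun s hs => ?_⟩
  have key : |q.eval s / p.eval s| ≤ max 0 (max c d) := by
    rcases le_total s N with h | h
    · exact (hd s ⟨hs, h⟩).trans ((le_max_right _ _).trans (le_max_right _ _))
    · have h3 := hN s h
      rw [Real.norm_eq_abs, Real.norm_eq_abs] at h3
      rw [abs_div, div_le_iff₀ (abs_pos.2 (hp s hs))]
      refine h3.trans (mul_le_mul_of_nonneg_right ?_ (abs_nonneg _))
      exact (le_max_left _ _).trans (le_max_right _ _)
  have h1s : 0 < 1 + s := by positivity
  rw [le_div_iff₀ h1s]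
  have : q.eval s / p.eval s = p.derivative.eval s / p.eval s * (1 + s) := by
    simp [hq]; ring
  rwa [this, abs_mul, abs_of_pos h1s] at key

theorem val_eq (R : RatFunc ℝ) (s : ℝ) : val R s = R.num.eval s / R.denom.eval s := by
  simp [val, RatFunc.eval, Polynomial.eval₂_id]

theorem IsStabilityFunction.val_pos {R : RatFunc ℝ} (hR : IsStabilityFunction R) {s : ℝ}
    (hs : 0 ≤ s) : 0 < val R s := by
  rcases hs.eq_or_lt with rfl | h
  · rw [hR.val_zero]; norm_num
  · exact (hR.mem_Ioo s h).1

theorem IsStabilityFunction.exists_log_deriv {R : RatFunc ℝ} (hR : IsStabilityFunction R) :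
    ∃ C : ℝ, 0 ≤ C ∧ ∀ s : ℝ, 0 ≤ s →
      ∃ d, HasDerivAt (fun x => Real.log (val R x)) d s ∧ |d| ≤ C / (1 + s) := by
  have hn : ∀ s : ℝ, 0 ≤ s → R.num.eval s ≠ 0 := fun s hs h => by
    have := hR.val_pos hs
    simp [val_eq, h] at this
  have hd : ∀ s : ℝ, 0 ≤ s → R.denom.eval s ≠ 0 := fun s hs h => by
    have := hR.val_pos hs
    simp [val_eq, h] at this
  obtain ⟨C, hC, h1⟩ := exists_abs_derivative_le _ hn
  obtain ⟨C', hC', h2⟩ := exists_abs_derivative_le _ hd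
  refine ⟨C + C', by positivity, fun s hs =>
    ⟨R.num.derivative.eval s / R.num.eval s - R.denom.derivative.eval s / R.denom.eval s, ?_, ?_⟩⟩
  · have h := ((R.num.hasDerivAt s).log (hn s hs)).sub ((R.denom.hasDerivAt s).log (hd s hs))
    refine h.congr_of_eventuallyEq ?_
    filter_upwards [R.num.continuous.continuousAt.eventually_ne (hn s hs),
      R.denom.continuous.continuousAt.eventually_ne (hd s hs)] with x hx hx'
    rw [val_eq, Real.log_div hx hx']
    rfl
  · refine (abs_sub _ _).trans ?_
    rw [add_div]
    exact add_le_add (h1 s hs) (h2 s hs)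

theorem abs_exp_sub_one_le_mul_exp {x A : ℝ} (h : |x| ≤ A) : |Real.exp x - 1| ≤ A * Real.exp A := by
  have h0 : 0 ≤ A := (abs_nonneg x).trans h
  obtain ⟨h1, h2⟩ := abs_le.1 h
  have h3 := Real.add_one_le_exp x
  have h4 := Real.add_one_le_exp (-x)
  have h5 : Real.exp x * Real.exp (-x) = 1 := by rw [← Real.exp_add]; simp
  have h6 : Real.exp x ≤ Real.exp A := Real.exp_le_exp.2 h2
  have h7 : 1 ≤ Real.exp A := Real.one_le_exp h0
  rw [abs_le]
  constructor
  · nlinarith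
  · have : Real.exp x - 1 ≤ Real.exp x * x := by nlinarith [Real.exp_pos x]
    have : Real.exp x * x ≤ Real.exp x * A := mul_le_mul_of_nonneg_left h2 (Real.exp_pos _).le
    nlinarith

/-- The quotients of the two coarse propagators are close to one. -/
theorem IsStabilityFunction.exists_ratio_bound {R : RatFunc ℝ} (hR : IsStabilityFunction R) :
    ∃ C : ℝ, 0 ≤ C ∧ ∀ z : ℝ, 0 < z → ∀ J : ℕ, 10 ≤ J →
      |val R ((J - 1) * z) / val R (J * z) - 1| ≤ C * min 1 (J * z) / J ∧
      |val R (J * z) / val R ((J - 1) * z) - 1| ≤ C * min 1 (J * z) / J := by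
  obtain ⟨C, hC, h⟩ := hR.exists_log_deriv
  refine ⟨2 * C * Real.exp (2 * C), by positivity, fun z hz J hJ => ?_⟩
  have hJ' : (10 : ℝ) ≤ J := by exact_mod_cast hJ
  have hJ0 : (0 : ℝ) < J := by linarith
  have ha : 0 ≤ (J - 1) * z := mul_nonneg (by linarith) hz.le
  have hb : 0 ≤ J * z := by positivity
  have hab : (J - 1) * z ≤ J * z := by linarith
  choose! d hd hdC using h
  have hlog : |Real.log (val R (J * z)) - Real.log (val R ((J - 1) * z))|
      ≤ C / (1 + (J - 1) * z) * |J * z - (J - 1) * z| := by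
    refine (convex_Icc ((J - 1) * z) (J * z)).norm_image_sub_le_of_norm_hasDerivWithin_le
      (f := fun x => Real.log (val R x)) (f' := d)
      (fun x hx => (hd x (ha.trans hx.1)).hasDerivWithinAt) (fun x hx => ?_)
      (Set.left_mem_Icc.2 hab) (Set.right_mem_Icc.2 hab)
    refine (hdC x (ha.trans hx.1)).trans ?_
    exact div_le_div_of_nonneg_left hC (by positivity) (by linarith [hx.1])
  have hz' : J * z - (J - 1) * z = z := by ring
  rw [hz', abs_of_pos hz] at hlog
  -- If `J * z ≥ 1`, the decay of the logarithmic derivative is used through `J - 1 ≥ J / 2`;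
  -- otherwise the denominator is at least `1` and can be dropped.
  have hm : C / (1 + (J - 1) * z) * z ≤ 2 * C * min 1 (J * z) / J := by
    rw [div_mul_eq_mul_div, div_le_div_iff₀ (by positivity) hJ0]
    rcases min_cases 1 (J * z) with ⟨h, _⟩ | ⟨h, _⟩ <;> rw [h]
    · have : z * J ≤ 2 * (1 + (J - 1) * z) := by nlinarith
      nlinarith
    · have : z * J ≤ 2 * (J * z) * (1 + (J - 1) * z) := by nlinarith [mul_nonneg hb ha]
      nlinarith
  have hm2 : 2 * C * min 1 (J * z) / J ≤ 2 * C := by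
    rw [div_le_iff₀ hJ0]
    have : min 1 (J * z) ≤ 1 := min_le_left _ _
    nlinarith
  have hpa := hR.val_pos ha
  have hpb := hR.val_pos hb
  have main : ∀ x : ℝ, |x| ≤ 2 * C * min 1 (J * z) / J →
      |Real.exp x - 1| ≤ 2 * C * Real.exp (2 * C) * min 1 (J * z) / J := fun x hx => by
    refine (abs_exp_sub_one_le_mul_exp hx).trans ?_
    have hm0 : 0 ≤ 2 * C * min 1 (J * z) / J := by positivity
    calc _ ≤ 2 * C * min 1 (J * z) / J * Real.exp (2 * C) :=
          mul_le_mul_of_nonneg_left (Real.exp_le_exp.2 hm2) hm0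
      _ = _ := by ring
  have hA := hlog.trans hm
  constructor
  · have := main _ (abs_sub_comm (Real.log (val R (J * z))) _ ▸ hA)
    rwa [Real.exp_sub, Real.exp_log hpa, Real.exp_log hpb] at this
  · have := main _ hA
    rwa [Real.exp_sub, Real.exp_log hpa, Real.exp_log hpb] at this

/-- Boundedness of the convergence function bounds `1 - R` from below. -/
theorem IsStabilityFunction.min_le {R : RatFunc ℝ} (hR : IsStabilityFunction R) {M : ℝ}
    (hM : ∀ s : ℝ, 0 < s → |gamma R s| ≤ M) {s : ℝ} (hs : 0 < s) :
    min 1 s ≤ 2 * (1 + M) * (1 - val R s) := by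
  obtain ⟨h0, h1⟩ := hR.mem_Ioo s hs
  have h := hM s hs
  rw [gamma, abs_of_pos h0, abs_div, abs_of_pos (sub_pos.2 h1), div_le_iff₀ (sub_pos.2 h1)] at h
  have h2 := (abs_le.1 h).1
  -- Combined with `1 - exp (-s) = (1 - R) - (exp (-s) - R) ≤ (1 + M) (1 - R)`.
  have h3 : min 1 s / 2 ≤ 1 - Real.exp (-s) := by
    have h4 := Real.add_one_le_exp s
    have h5 : Real.exp s * Real.exp (-s) = 1 := by rw [← Real.exp_add]; simp
    have h6 : (s + 1) * Real.exp (-s) ≤ 1 := by nlinarith [Real.exp_pos (-s)]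
    have h7 : min 1 s * (s + 1) ≤ 2 * s := by
      rcases min_cases 1 s with ⟨h, _⟩ | ⟨h, _⟩ <;> rw [h] <;> nlinarith
    have h8 : (s + 1) * (min 1 s / 2) ≤ (s + 1) * (1 - Real.exp (-s)) := by nlinarith
    exact le_of_mul_le_mul_left h8 (by positivity)
  linarith

/-! ### The series defining `gammaA`. -/

/-- The series `∑ gᵐ |(m + 1) x² + y|` converges and is close to `(x / (1 - g))²`. -/
theorem summable_and_abs_tsum_sub_le {g : ℝ} (hg : 0 < g) (hg1 : g < 1) (x y : ℝ) :
    Summable (fun m : ℕ => g ^ m * |((m : ℝ) + 1) * x ^ 2 + y|) ∧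
    |∑' m : ℕ, g ^ m * |((m : ℝ) + 1) * x ^ 2 + y| - (x / (1 - g)) ^ 2| ≤ |y| / (1 - g) := by
  have hD : 0 < 1 - g := sub_pos.2 hg1
  have h1 : HasSum (fun m : ℕ => g ^ m) (1 - g)⁻¹ := hasSum_geometric_of_lt_one hg.le hg1
  have h2 : HasSum (fun m : ℕ => (m : ℝ) * g ^ m) (g / (1 - g) ^ 2) :=
    hasSum_coe_mul_geometric_of_norm_lt_one (by rwa [Real.norm_eq_abs, abs_of_pos hg])
  have h3 : HasSum (fun m : ℕ => g ^ m * (((m : ℝ) + 1) * x ^ 2)) ((x / (1 - g)) ^ 2) := by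
    convert! (h2.add h1).mul_right (x ^ 2) using 1
    · ext m; ring
    · field_simp; ring
  have h4 : HasSum (fun m : ℕ => g ^ m * |y|) (|y| / (1 - g)) := by
    convert! h1.mul_right |y| using 1
    rw [div_eq_inv_mul]
  have hle : ∀ m : ℕ, g ^ m * |((m : ℝ) + 1) * x ^ 2 + y|
      ≤ g ^ m * (((m : ℝ) + 1) * x ^ 2) + g ^ m * |y| := fun m => by
    rw [← mul_add]
    refine mul_le_mul_of_nonneg_left ((abs_add_le _ _).trans ?_) (by positivity)
    rw [abs_of_nonneg (by positivity : 0 ≤ ((m : ℝ) + 1) * x ^ 2)]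
  have hge : ∀ m : ℕ, g ^ m * (((m : ℝ) + 1) * x ^ 2) - g ^ m * |y|
      ≤ g ^ m * |((m : ℝ) + 1) * x ^ 2 + y| := fun m => by
    rw [← mul_sub]
    refine mul_le_mul_of_nonneg_left ?_ (by positivity)
    have := le_abs_self (((m : ℝ) + 1) * x ^ 2 + y)
    have := neg_abs_le y
    linarith
  have hs : Summable (fun m : ℕ => g ^ m * |((m : ℝ) + 1) * x ^ 2 + y|) :=
    Summable.of_nonneg_of_le (fun m => by positivity) hle (h3.add h4).summable
  refine ⟨hs, ?_⟩
  have hu := hasSum_le hle hs.hasSum (h3.add h4)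
  have hl := hasSum_le hge (h3.sub h4) hs.hasSum
  rw [abs_le]
  constructor <;> linarith

/-! ### Estimates of the `eta` coefficients. -/

theorem G_one (R : RatFunc ℝ) (z : ℝ) {J : ℕ} (hJ : 0 < J) : G R 1 z J = val R (J * z) := by
  have : (J : ℝ) ≠ 0 := by exact_mod_cast hJ.ne'
  simp [G, this]

theorem G_two (R : RatFunc ℝ) (z : ℝ) {J : ℕ} (hJ : 0 < J) :
    G R 2 z J = val R ((J - 1) * z) := by
  have : (J : ℝ) ≠ 0 := by exact_mod_cast hJ.ne'
  unfold G
  congr 1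
  push_cast
  field_simp
  ring

/-- The estimates of the coefficients of the error recursion. -/
structure EtaBound (R : RatFunc ℝ) (z : ℝ) (J : ℕ) (K : ℝ) : Prop where
  one_le : 1 ≤ K
  pos : 0 < G R 1 z J
  lt_one : G R 1 z J < 1
  abs_eta₁ : |eta₁ R z J| ≤ K / J
  abs_eta₂ : |eta₂ R z J| / (1 - G R 1 z J) ≤ K / J
  abs_eta₃ : |eta₃ R z J| ≤ K
  abs_eta₄ : |eta₄ R z J| / (1 - G R 1 z J) ≤ K
  abs_gamma : |gamma R (J * z)| ≤ K
  abs_sub_gamma : |eta₄ R z J / (1 - G R 1 z J) - gamma R (J * z)| ≤ K / J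

theorem exists_etaBound (R : RatFunc ℝ) (hR : IsStabilityFunction R)
    (hγ : BddAbove ((fun s : ℝ => |gamma R s|) '' Set.Ioi 0)) :
    ∃ K : ℝ, ∀ z : ℝ, 0 < z → ∀ J : ℕ, 10 ≤ J → EtaBound R z J K := by
  obtain ⟨M, hM⟩ := hγ
  replace hM : ∀ s : ℝ, 0 < s → |gamma R s| ≤ M := fun s hs => hM ⟨s, hs, rfl⟩
  have hM0 : 0 ≤ M := (abs_nonneg _).trans (hM 1 one_pos)
  obtain ⟨C, hC, hratio⟩ := hR.exists_ratio_bound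
  -- `100000` dominates the BDF2 errors, and `8 * C` the two ratio errors in `eta₂`, each multiplied
  -- by a fine coefficient of size at most `4`. Passing from `m` to `1 - g` costs `2 * (1 + M)`.
  set L : ℝ := 100000 + 8 * C with hL
  have hL0 : 0 < L := by positivity
  set K : ℝ := L * (2 * (1 + M)) + M with hK
  have hLK : L ≤ K := by nlinarith
  refine ⟨K, fun z hz J hJ => ?_⟩
  have hJ0 : 0 < J := by omega
  have hJ' : (0 : ℝ) < J := by exact_mod_cast hJ0
  have hJ1 : (1 : ℝ) ≤ J := by exact_mod_cast hJ0
  have hs : 0 < J * z := by positivity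
  have ha : 0 ≤ (J - 1) * z := mul_nonneg (by linarith) hz.le
  obtain ⟨hr1, hr2⟩ := hratio z hz J hJ
  have hg := hR.mem_Ioo _ hs
  have hg2 := hR.val_pos ha
  have hmin := hR.min_le hM hs
  set m := min 1 (J * z) with hm
  have hm0 : 0 < m := lt_min one_pos hs
  have hm1 : m ≤ 1 := min_le_left _ _
  set g := val R (J * z) with hgdef
  set q := val R ((J - 1) * z) / g - 1 with hq
  set r := g / val R ((J - 1) * z) - 1 with hr
  have hD : 0 < 1 - g := sub_pos.2 hg.2
  have hF1 := abs_F₁_le hz J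
  have hF2 := abs_F₂_le hz (J - 1)
  have hd1 := abs_F₁_sub_le hz hJ
  have hd2 := abs_F₁_add_F₂_sub_le hz hJ
  have hd3 := abs_F₁_add_F₂_sub_exp_le hz hJ
  have e1 : eta₁ R z J = (F₁ (J - 1) z - F₁ J z) - F₁ J z * q := by
    rw [eta₁, G_one R z hJ0, G_two R z hJ0, hq]; ring
  have e2 : eta₂ R z J = ((F₁ (J - 1) z + F₂ (J - 1) z) - (F₁ J z + F₂ J z))
      + F₂ (J - 1) z * r - F₁ J z * q := by
    rw [eta₂, G_one R z hJ0, G_two R z hJ0, hq, hr]; ring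
  have e3 : eta₃ R z J = F₁ J z * (q + 1) := by
    rw [eta₃, G_one R z hJ0, G_two R z hJ0, hq]; ring
  -- The first bracket is exactly `(1 - g) * gamma R (J * z)`; the rest is `O(m / J)`.
  have e4 : eta₄ R z J = (Real.exp (-(J * z)) - g)
      + ((F₁ J z + F₂ J z - Real.exp (-(J * z))) + F₁ J z * q) := by
    rw [eta₄, G_one R z hJ0, G_two R z hJ0, hq]; ring
  have hFq : |F₁ J z * q| ≤ 4 * (C * m / J) := by
    rw [abs_mul]; exact mul_le_mul hF1 hr1 (abs_nonneg _) (by norm_num)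
  have hFr : |F₂ (J - 1) z * r| ≤ 4 * (C * m / J) := by
    rw [abs_mul]; exact mul_le_mul hF2 hr2 (abs_nonneg _) (by norm_num)
  have hmJ : m / J ≤ 1 / J := by gcongr
  have hJinv : 1 / (J : ℝ) ≤ 1 := by rw [div_le_one hJ']; exact hJ1
  have hmJ0 : 0 < m / J := by positivity
  have hKL : L * (2 * (1 + M)) / J ≤ K / J := by gcongr; linarith
  have hLJ : L * (m / J) ≤ L * (2 * (1 + M)) / J * (1 - g) :=
    calc L * (m / J) ≤ L * (2 * (1 + M) * (1 - g) / J) := by gcongr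
      _ = _ := by ring
  have hKJ : L * (m / J) ≤ K / J * (1 - g) :=
    hLJ.trans (mul_le_mul_of_nonneg_right hKL hD.le)
  have hCmJ : 0 ≤ C * (m / J) := by positivity
  have hgam : gamma R (J * z) = (Real.exp (-(J * z)) - g) / (1 - g) := by
    rw [gamma, ← hgdef, abs_of_pos hg.1]
  have hdiff : |eta₄ R z J / (1 - g) - gamma R (J * z)| ≤ L * (2 * (1 + M)) / J := by
    rw [hgam, ← sub_div, e4, add_sub_cancel_left, abs_div, abs_of_pos hD, div_le_iff₀ hD]
    refine (abs_add_le _ _).trans ?_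
    have h1 : 100000 * m / J + 4 * (C * m / J) ≤ L * (m / J) := by
      rw [hL, mul_div_assoc, mul_div_assoc, add_mul]; linarith
    exact (add_le_add hd3 hFq).trans (h1.trans hLJ)
  refine ⟨by linarith, ?_, ?_, ?_, ?_, ?_, ?_, ?_, ?_⟩
  · rw [G_one R z hJ0]; exact hg.1
  · rw [G_one R z hJ0]; exact hg.2
  · rw [e1]
    refine (abs_sub _ _).trans ?_
    have h1 : (320 / J + 4 * (C * m / J) : ℝ) ≤ L / J := by
      rw [mul_div_assoc', ← add_div]; gcongr
      linarith [mul_le_of_le_one_right hC hm1]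
    have h2 : L / J ≤ K / J := by gcongr
    linarith
  · rw [G_one R z hJ0, div_le_iff₀ hD, e2]
    refine (abs_sub _ _).trans ?_
    have h0 := abs_add_le ((F₁ (J - 1) z + F₂ (J - 1) z) - (F₁ J z + F₂ J z))
      (F₂ (J - 1) z * r)
    have h1 : 320 * m / J + 4 * (C * m / J) + 4 * (C * m / J) ≤ L * (m / J) := by
      rw [hL, mul_div_assoc, mul_div_assoc, add_mul]; linarith
    linarith
  · rw [e3, mul_add, mul_one]
    refine (abs_add_le _ _).trans ?_
    have h1 : C * m / J ≤ C := by
      rw [mul_div_assoc]; exact mul_le_of_le_one_right hC (hmJ.trans hJinv)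
    linarith
  · have h1 := abs_sub_abs_le_abs_sub (eta₄ R z J / (1 - g)) (gamma R (J * z))
    have h2 := hM _ hs
    have h3 : L * (2 * (1 + M)) / J ≤ L * (2 * (1 + M)) := by
      rw [div_le_iff₀ hJ']; exact le_mul_of_one_le_right (by positivity) hJ1
    rw [abs_div, abs_of_pos hD] at h1
    rw [G_one R z hJ0]
    linarith
  · have h2 := hM _ hs
    have : 0 ≤ L * (2 * (1 + M)) := by positivity
    linarith
  · rw [G_one R z hJ0]; exact hdiff.trans hKL

/-! ### Bounds on the entries of the error matrix. -/

namespace EtaBound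

variable {R : RatFunc ℝ} {z : ℝ} {J : ℕ} {K : ℝ}

theorem abs_eta₂_mul_eta₃_le (h : EtaBound R z J K) :
    |eta₂ R z J * eta₃ R z J| / (1 - G R 1 z J) ≤ K ^ 2 / J := by
  have hK := h.one_le
  rw [abs_mul, mul_div_right_comm]
  refine (mul_le_mul h.abs_eta₂ h.abs_eta₃ (abs_nonneg _) (by positivity)).trans (le_of_eq ?_)
  ring

theorem one_sub_pos (h : EtaBound R z J K) : 0 < 1 - G R 1 z J := sub_pos.2 h.lt_one

theorem summable_gammaATerm (h : EtaBound R z J K) : Summable (gammaATerm R z J) := by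
  have := (summable_and_abs_tsum_sub_le h.pos h.lt_one (eta₄ R z J)
    (eta₂ R z J * eta₃ R z J)).1
  unfold gammaATerm
  rwa [abs_of_pos h.pos]

theorem abs_gammaA_sub_le (h : EtaBound R z J K) :
    |gammaA R z J - gamma R (J * z) ^ 2| ≤ 3 * K ^ 2 / J := by
  have h1 := (summable_and_abs_tsum_sub_le h.pos h.lt_one (eta₄ R z J)
    (eta₂ R z J * eta₃ R z J)).2.trans h.abs_eta₂_mul_eta₃_le
  have hA : gammaA R z J = ∑' m : ℕ, G R 1 z J ^ m *
      |((m : ℝ) + 1) * eta₄ R z J ^ 2 + eta₂ R z J * eta₃ R z J| := by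
    unfold gammaA gammaATerm
    rw [abs_of_pos h.pos]
  rw [← hA] at h1
  have hK := h.one_le
  have h2 : |(eta₄ R z J / (1 - G R 1 z J)) ^ 2 - gamma R (J * z) ^ 2| ≤ 2 * K * (K / J) := by
    rw [sq_sub_sq, abs_mul]
    refine mul_le_mul ((abs_add_le _ _).trans ?_) h.abs_sub_gamma (abs_nonneg _) (by positivity)
    have h3 := h.abs_eta₄
    rw [abs_div, abs_of_pos h.one_sub_pos]
    linarith [h.abs_gamma]
  refine (abs_sub_le _ ((eta₄ R z J / (1 - G R 1 z J)) ^ 2) _).trans ((add_le_add h1 h2).trans ?_)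
  exact le_of_eq (by ring)

theorem gammaE_le (h : EtaBound R z J K) (hJ : 0 < J) : gammaE R z J ≤ 3 * K ^ 2 / J := by
  have hJ' : (1 : ℝ) ≤ J := by exact_mod_cast hJ
  have hK := h.one_le
  have hD := h.one_sub_pos
  have hg := h.pos
  have h1 := h.abs_eta₂_mul_eta₃_le
  have h2 : |G R 1 z J * eta₂ R z J * eta₃ R z J| / (1 - G R 1 z J) ≤ K ^ 2 / J := by
    refine le_trans ?_ h1
    rw [mul_assoc, abs_mul, abs_of_pos hg]
    gcongr
    exact mul_le_of_le_one_left (abs_nonneg _) h.lt_one.le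
  have h3 : |eta₂ R z J * eta₃ R z J| ≤ K ^ 2 / J := by
    refine le_trans ?_ h1
    rw [le_div_iff₀ hD]
    exact mul_le_of_le_one_right (abs_nonneg _) (by linarith)
  have h4 : eta₁ R z J ^ 2 ≤ K ^ 2 / J := by
    rw [← sq_abs]
    refine (pow_le_pow_left₀ (abs_nonneg _) h.abs_eta₁ 2).trans ?_
    rw [div_pow]
    gcongr
    exact le_self_pow₀ hJ' (by norm_num)
  have h5 := abs_add_le (eta₂ R z J * eta₃ R z J) (eta₁ R z J ^ 2)
  rw [abs_of_nonneg (sq_nonneg (eta₁ R z J))] at h5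
  unfold gammaE
  rw [abs_of_pos hg]
  calc _ ≤ K ^ 2 / J + (K ^ 2 / J + K ^ 2 / J) := by linarith
    _ = _ := by ring

theorem gammaB_le (h : EtaBound R z J K) (hJ : 0 < J) : gammaB R z J ≤ 4 * K ^ 4 / J := by
  have hJ' : (1 : ℝ) ≤ J := by exact_mod_cast hJ
  have hK := h.one_le
  have hD := h.one_sub_pos
  have h1 : |eta₁ R z J| ≤ K :=
    h.abs_eta₁.trans (div_le_self (by linarith) hJ')
  have h2 := h.abs_eta₄
  unfold gammaB
  rw [abs_of_pos h.pos]
  calc _ ≤ K ^ 2 / J * (K + K) ^ 2 := by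
        refine mul_le_mul h.abs_eta₂_mul_eta₃_le ?_ (by positivity) (by positivity)
        exact pow_le_pow_left₀ (by positivity) (add_le_add h1 h2) 2
    _ = _ := by ring

/-- Pairing each `eta₂` and `eta₄` with one `1 - G₁` leaves exactly one unpaired denominator in
every summand. It cancels against the factor `1 - G₁` in `gammaD_le`, which is why `gammaC * gammaD`
is estimated as a product. -/
theorem gammaC_le (h : EtaBound R z J K) (hJ : 0 < J) :
    gammaC R z J ≤ 4 * K ^ 4 / J / (1 - G R 1 z J) := by
  have hJ' : (1 : ℝ) ≤ J := by exact_mod_cast hJ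
  have hJ0 : (0 : ℝ) < J := by exact_mod_cast hJ
  have hK := h.one_le
  have hD := h.one_sub_pos
  have h1' := h.abs_eta₁
  have h2' := h.abs_eta₂
  have h3' := h.abs_eta₃
  have h4' := h.abs_eta₄
  have h1K : |eta₁ R z J| ≤ K := h1'.trans (div_le_self (by linarith) hJ')
  unfold gammaC
  rw [abs_of_pos h.pos]
  simp only [abs_mul, abs_pow]
  set D := 1 - G R 1 z J with hDdef
  set a := |eta₁ R z J|
  set b := |eta₂ R z J| / D with hb
  set c := |eta₃ R z J|
  set d := |eta₄ R z J| / D with hd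
  have hb0 : 0 ≤ b := by positivity
  have hd0 : 0 ≤ d := by positivity
  have ha0 : 0 ≤ a := abs_nonneg _
  have hc0 : 0 ≤ c := abs_nonneg _
  have t1 : b * c ^ 2 * d ≤ K / J * K ^ 2 * K := by gcongr
  have t2 : a * b * c ^ 2 ≤ K * (K / J) * K ^ 2 := by gcongr
  have t3 : a * a * c * d ≤ K / J * K * K * K := by gcongr
  have t4 : a * a ^ 2 * c ≤ K / J * K ^ 2 * K := by gcongr
  calc _ = (b * c ^ 2 * d + a * b * c ^ 2 + a * a * c * d + a * a ^ 2 * c) / D := by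
        rw [hb, hd]; field_simp
    _ ≤ (K / J * K ^ 2 * K + K * (K / J) * K ^ 2 + K / J * K * K * K + K / J * K ^ 2 * K) / D := by
        gcongr
    _ = _ := by ring

theorem gammaD_le (h : EtaBound R z J K) (hJ : 0 < J) :
    gammaD R z J ≤ 3 * K ^ 2 / J * (1 - G R 1 z J) := by
  have hJ' : (1 : ℝ) ≤ J := by exact_mod_cast hJ
  have hK := h.one_le
  have hD := h.one_sub_pos
  have hg := h.pos
  have h1K : |eta₁ R z J| ≤ K := h.abs_eta₁.trans (div_le_self (by linarith) hJ')
  have h4K : |eta₄ R z J| ≤ K := by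
    refine le_trans ?_ h.abs_eta₄
    rw [le_div_iff₀ hD]
    exact mul_le_of_le_one_right (abs_nonneg _) (by linarith)
  have h2 := h.abs_eta₂
  rw [div_le_iff₀ hD] at h2
  have h4 := h.abs_eta₄
  have t1 : |G R 1 z J * eta₂ R z J * eta₄ R z J| / (1 - G R 1 z J)
      ≤ K / J * (1 - G R 1 z J) * K := by
    rw [abs_mul, abs_mul, abs_of_pos hg, mul_div_assoc]
    refine mul_le_mul ?_ h4 (by positivity) (by positivity)
    exact (mul_le_of_le_one_left (abs_nonneg _) h.lt_one.le).trans h2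
  have t2 : |eta₂ R z J * (eta₄ R z J + eta₁ R z J)| ≤ K / J * (1 - G R 1 z J) * (K + K) := by
    rw [abs_mul]
    exact mul_le_mul h2 ((abs_add_le _ _).trans (add_le_add h4K h1K)) (abs_nonneg _)
      (by positivity)
  unfold gammaD
  rw [abs_of_pos hg]
  calc _ ≤ _ := add_le_add t1 t2
    _ = _ := by ring

end EtaBound

theorem gammaB_nonneg {R : RatFunc ℝ} {z : ℝ} {J : ℕ} (h : G R 1 z J ∈ Set.Ioo (0 : ℝ) 1) :
    0 ≤ gammaB R z J := by
  have : 0 < 1 - |G R 1 z J| := by rw [abs_of_pos h.1]; exact sub_pos.2 h.2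
  unfold gammaB; positivity

theorem gammaC_nonneg {R : RatFunc ℝ} {z : ℝ} {J : ℕ} (h : G R 1 z J ∈ Set.Ioo (0 : ℝ) 1) :
    0 ≤ gammaC R z J := by
  have : 0 < 1 - |G R 1 z J| := by rw [abs_of_pos h.1]; exact sub_pos.2 h.2
  unfold gammaC; positivity

theorem gammaD_nonneg {R : RatFunc ℝ} {z : ℝ} {J : ℕ} (h : G R 1 z J ∈ Set.Ioo (0 : ℝ) 1) :
    0 ≤ gammaD R z J := by
  have : 0 < 1 - |G R 1 z J| := by rw [abs_of_pos h.1]; exact sub_pos.2 h.2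
  unfold gammaD; positivity

theorem gammaE_nonneg {R : RatFunc ℝ} {z : ℝ} {J : ℕ} (h : G R 1 z J ∈ Set.Ioo (0 : ℝ) 1) :
    0 ≤ gammaE R z J := by
  have : 0 < 1 - |G R 1 z J| := by rw [abs_of_pos h.1]; exact sub_pos.2 h.2
  unfold gammaE; positivity

/-! ### The characteristic polynomial and the final estimate. -/

theorem errorMatrix_charpoly (R : RatFunc ℝ) (z : ℝ) (J : ℕ) :
    (errorMatrix R z J).charpoly = Polynomial.X ^ 3
      - Polynomial.C (gammaA R z J + gammaE R z J) * Polynomial.X ^ 2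
      + Polynomial.C (gammaA R z J * gammaE R z J - gammaB R z J) * Polynomial.X
      + Polynomial.C (gammaB R z J * gammaE R z J - gammaC R z J * gammaD R z J) := by
  simp [Matrix.charpoly, Matrix.det_fin_three, errorMatrix]
  ring

theorem abs_coeff_cubic_le {p q r t B : ℝ} (hB : 0 ≤ B) (hp : |p - t| ≤ B) (hq : |q| ≤ B)
    (hr : |r| ≤ B) (i : ℕ) :
    |(Polynomial.X ^ 3 - Polynomial.C p * Polynomial.X ^ 2 + Polynomial.C q * Polynomial.X
        + Polynomial.C r : Polynomial ℝ).coeff i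
      - (Polynomial.X ^ 3 - Polynomial.C t * Polynomial.X ^ 2 : Polynomial ℝ).coeff i| ≤ B := by
  have h : (Polynomial.X ^ 3 - Polynomial.C p * Polynomial.X ^ 2 + Polynomial.C q * Polynomial.X
        + Polynomial.C r : Polynomial ℝ) - (Polynomial.X ^ 3 - Polynomial.C t * Polynomial.X ^ 2)
      = Polynomial.C (-(p - t)) * Polynomial.X ^ 2 + Polynomial.C q * Polynomial.X
        + Polynomial.C r := by
    simp only [Polynomial.C_neg, Polynomial.C_sub]; ring
  rw [← Polynomial.coeff_sub, h]
  rw [← abs_neg] at hp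
  generalize -(p - t) = w at hp ⊢
  match i with
  | 0 => simpa [Polynomial.coeff_X] using hr
  | 1 => simpa [Polynomial.coeff_X_pow, Polynomial.coeff_C] using hq
  | 2 => simpa [Polynomial.coeff_X, Polynomial.coeff_C] using hp
  | i + 3 => simpa [Polynomial.coeff_X_pow, Polynomial.coeff_X, Polynomial.coeff_C] using hB

end Parareal

theorem theorem5p1 (R : RatFunc ℝ) (hR : IsStabilityFunction R)
    (hγ : BddAbove ((fun s : ℝ => |Parareal.gamma R s|) '' Set.Ioi 0)) :
    ∃ C : ℝ, ∀ z : ℝ, 0 < z → ∀ J : ℕ, 10 ≤ J →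
      Summable (gammaATerm R z J) ∧
      |gammaA R z J - Parareal.gamma R (J * z) ^ 2| ≤ C / J ∧
      gammaE R z J ≤ C / J ∧
      gammaB R z J ≤ C / J ∧
      gammaC R z J * gammaD R z J ≤ C / (J : ℝ) ^ 2 ∧
      (∀ i : ℕ, |(errorMatrix R z J).charpoly.coeff i -
        (Polynomial.X ^ 3 - Polynomial.C (Parareal.gamma R (J * z) ^ 2) *
          Polynomial.X ^ 2 : Polynomial ℝ).coeff i| ≤ C / J) ∧
      |(errorMatrix R z J).charpoly.coeff 0| ≤ C / (J : ℝ) ^ 2 := by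
  obtain ⟨K, hK⟩ := exists_etaBound R hR hγ
  -- The constant coefficient dictates the choice: `gammaB * gammaE` and `gammaC * gammaD` each
  -- contribute `12 * K ^ 6`. All other bounds are smaller since `1 ≤ K`.
  refine ⟨24 * K ^ 6, fun z hz J hJ => ?_⟩
  have h := hK z hz J hJ
  have hJ0 : 0 < J := by omega
  have hJ' : (1 : ℝ) ≤ J := by exact_mod_cast hJ0
  have hJpos : (0 : ℝ) < J := by linarith
  have hK1 := h.one_le
  have hD := h.one_sub_pos
  have hG : G R 1 z J ∈ Set.Ioo (0 : ℝ) 1 := ⟨h.pos, h.lt_one⟩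
  have hB0 := gammaB_nonneg hG
  have hC0 := gammaC_nonneg hG
  have hD0 := gammaD_nonneg hG
  have hE0 := gammaE_nonneg hG
  have hA := h.abs_gammaA_sub_le
  have hE := h.gammaE_le hJ0
  have hB := h.gammaB_le hJ0
  have hCD : gammaC R z J * gammaD R z J ≤ 12 * K ^ 6 / (J : ℝ) ^ 2 := by
    refine (mul_le_mul (h.gammaC_le hJ0) (h.gammaD_le hJ0) hD0 (by positivity)).trans
      (le_of_eq ?_)
    field_simp
    ring
  have hBE : gammaB R z J * gammaE R z J ≤ 12 * K ^ 6 / (J : ℝ) ^ 2 := by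
    refine (mul_le_mul hB hE hE0 (by positivity)).trans (le_of_eq ?_)
    field_simp
    ring
  have h26 : K ^ 2 ≤ K ^ 6 := pow_le_pow_right₀ hK1 (by norm_num)
  have h46 : K ^ 4 ≤ K ^ 6 := pow_le_pow_right₀ hK1 (by norm_num)
  have hK6 : 0 < K ^ 6 := by positivity
  have hdiv : ∀ {x y : ℝ}, x ≤ y → x / J ≤ y / J := fun hxy => by gcongr
  have hAE : |gammaA R z J + gammaE R z J - Parareal.gamma R (J * z) ^ 2|
      ≤ 24 * K ^ 6 / J := by
    have h1 := abs_add_le (gammaA R z J - Parareal.gamma R (J * z) ^ 2) (gammaE R z J)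
    rw [abs_of_nonneg hE0, sub_add_eq_add_sub] at h1
    calc _ ≤ 3 * K ^ 2 / J + 3 * K ^ 2 / J := by linarith
      _ = 6 * K ^ 2 / J := by ring
      _ ≤ _ := hdiv (by linarith)
  have hAabs : |gammaA R z J| ≤ 4 * K ^ 2 := by
    have h1 := abs_sub_abs_le_abs_sub (gammaA R z J) (Parareal.gamma R (J * z) ^ 2)
    have h2 : |Parareal.gamma R (J * z) ^ 2| ≤ K ^ 2 := by
      rw [abs_pow]; exact pow_le_pow_left₀ (abs_nonneg _) h.abs_gamma 2
    have h3 : 3 * K ^ 2 / J ≤ 3 * K ^ 2 := div_le_self (by positivity) hJ'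
    linarith
  have hAEB : |gammaA R z J * gammaE R z J - gammaB R z J| ≤ 24 * K ^ 6 / J := by
    refine (abs_sub _ _).trans ?_
    rw [abs_mul, abs_of_nonneg hE0, abs_of_nonneg hB0]
    have h1 := mul_le_mul hAabs hE hE0 (by positivity)
    calc _ ≤ 4 * K ^ 2 * (3 * K ^ 2 / J) + 4 * K ^ 4 / J := add_le_add h1 hB
      _ = 16 * K ^ 4 / J := by ring
      _ ≤ _ := hdiv (by linarith)
  have hconst : |gammaB R z J * gammaE R z J - gammaC R z J * gammaD R z J|
      ≤ 24 * K ^ 6 / (J : ℝ) ^ 2 := by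
    refine (abs_sub _ _).trans ?_
    rw [abs_of_nonneg (mul_nonneg hB0 hE0), abs_of_nonneg (mul_nonneg hC0 hD0)]
    calc _ ≤ _ := add_le_add hBE hCD
      _ = _ := by ring
  have hJJ : 24 * K ^ 6 / (J : ℝ) ^ 2 ≤ 24 * K ^ 6 / J := by
    gcongr
    exact le_self_pow₀ hJ' (by norm_num)
  refine ⟨h.summable_gammaATerm, hA.trans (hdiv (by linarith)), hE.trans (hdiv (by linarith)),
    hB.trans (hdiv (by linarith)), hCD.trans ?_, ?_, ?_⟩
  · gcongr
    norm_num
  · rw [errorMatrix_charpoly]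
    exact abs_coeff_cubic_le (by positivity) hAE hAEB (hconst.trans hJJ)
  · rw [errorMatrix_charpoly]
    simpa using hconst
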